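/- Let $k\ge 1$ be an integer, let $q=\frac{1}{2k+2}$, and let $x_k=(3,\underbrace{2,\dots,2}_{k\text{ times}};q)$ be the multigeometric sequence $$3,\underbrace{2,\dots,2}_{k},\,3q,\underbrace{2q,\dots,2q}_{k},\,3q^2,\underbrace{2q^2,\dots,2q^2}_{k},\dots$$ Then its achievement set $$E(x_k)=\Big\{\sum_{n=1}^{\infty}\varepsilon_n x_k(n) : \varepsilon_n\in\{0,1\}\text{ for all } n\Big\}$$ is a Cantorval, that is, a non-empty compact subset $S$ of $\mathbb{R}$ such that $S$ is the closure of its interior and both endpoints of every connected component of $S$ with non-empty interior are accumulation points of the set of one-point components of $S$. -/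

import Mathlib

open Topology Filter

/-- The multigeometric sequence `(k₁, …, kₘ; q)`, that is
`k₁, …, kₘ, k₁ q, …, kₘ q, k₁ q², …, kₘ q², …`, indexed from `0`. -/
noncomputable def multigeometric {m : ℕ} [NeZero m] (k : Fin m → ℝ) (q : ℝ) : ℕ → ℝ :=
  fun n => k (Fin.ofNat m n) * q ^ (n / m)

/-- The achievement set of `x`: the set of all sums `∑ εₙ x(n)` with `εₙ ∈ {0, 1}`. -/
def achievementSet (x : ℕ → ℝ) : Set ℝ :=
  {t | ∃ ε : ℕ → ℝ, (∀ n, ε n = 0 ∨ ε n = 1) ∧ HasSum (fun n => ε n * x n) t}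

/-- The union of the one-point connected components of `S`. -/
def onePointComponents (S : Set ℝ) : Set ℝ :=
  {y | y ∈ S ∧ connectedComponentIn S y = {y}}

/-- A Cantorval (more precisely, an `M`-Cantorval): a non-empty compact subset of the real line
which is the closure of its interior, and such that both endpoints of any component with
non-empty interior are accumulation points of one-point components. The components of a compact
`S` are compact intervals, so that their endpoints are their least and greatest elements. -/
structure IsCantorval (S : Set ℝ) : Prop where
  nonempty : S.Nonempty
  isCompact : IsCompact S
  closure_interior : closure (interior S) = S
  accPt_endpoint : ∀ x ∈ S, (interior (connectedComponentIn S x)).Nonempty →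
    ∀ a, (IsLeast (connectedComponentIn S x) a ∨ IsGreatest (connectedComponentIn S x) a) →
      AccPt a (𝓟 (onePointComponents S))

/-! ### Achievement sets of summable nonnegative sequences. -/

section AchievementSet

variable {x : ℕ → ℝ}

/-! Write `N = 2k + 2`. The set `S` satisfies `S = D + S / N` with digits `D = {3a + 2c}`, and `S ⊆
[0, M]`, `M = N(2k + 3)/(2k + 1)`. Interior: `D` is a complete residue system mod `N`, so level-`n`
digit sums fill a long block of integers (`mem_digitSums`); rescaled, they become dense in an
interval. Small copies of that interval lie near every point of `S`. Endpoints: since `M < 2N`, `S`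
misses `(M/N, 2)`, hence has scaled gaps arbitrarily close to `0` on its right. A point isolated
from the left in `S` inherits these gaps, so it starts no interval
(`not_Icc_subset_of_selfSimilar`). Thus a left endpoint of a nontrivial component is a limit of
gaps, whose right ends are one-point components. The symmetry `y ↦ M - y` handles right endpoints.
-/

theorem isCompact_achievementSet (hx : Summable x) (h0 : ∀ n, 0 ≤ x n) :
    IsCompact (achievementSet x) := by
  have hle : ∀ (b : ℕ → Bool) n, ‖(if b n then (1 : ℝ) else 0) * x n‖ ≤ x n := by
    intro b n
    split_ifs <;> simp [abs_of_nonneg (h0 n), h0 n]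
  have hE : achievementSet x =
      Set.range (fun b : ℕ → Bool => ∑' n, (if b n then (1 : ℝ) else 0) * x n) := by
    classical
    ext t
    constructor
    · rintro ⟨ε, hε, ht⟩
      refine ⟨fun n => decide (ε n = 1), ?_⟩
      rw [← ht.tsum_eq]
      refine tsum_congr fun n => ?_
      rcases hε n with h | h <;> simp [h]
    · rintro ⟨b, rfl⟩
      exact ⟨fun n => if b n then 1 else 0, fun n => by dsimp only; split_ifs <;> simp,
        (Summable.of_norm_bounded hx (hle b)).hasSum⟩
  rw [hE]
  -- A continuous image of the Cantor space `ℕ → Bool`; the series converges uniformly since `x`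
  -- dominates it.
  refine isCompact_range (continuous_tsum (fun n => ?_) hx fun n b => hle b n)
  have : Continuous fun c : Bool => if c then (1 : ℝ) else 0 := continuous_of_discreteTopology
  exact (this.comp (continuous_apply n)).mul continuous_const

theorem zero_mem_achievementSet : (0 : ℝ) ∈ achievementSet x :=
  ⟨fun _ => 0, fun _ => Or.inl rfl, by simp [hasSum_zero]⟩

theorem nonneg_of_mem_achievementSet (h0 : ∀ n, 0 ≤ x n) {t : ℝ} (ht : t ∈ achievementSet x) :
    0 ≤ t := by
  obtain ⟨ε, hε, h⟩ := ht
  refine h.nonneg fun n => mul_nonneg ?_ (h0 n)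
  rcases hε n with h | h <;> simp [h]

theorem sub_mem_achievementSet {M : ℝ} (hM : HasSum x M) {t : ℝ} (ht : t ∈ achievementSet x) :
    M - t ∈ achievementSet x := by
  obtain ⟨ε, hε, h⟩ := ht
  refine ⟨fun n => 1 - ε n, fun n => ?_, ?_⟩
  · rcases hε n with h | h <;> simp [h]
  · simpa [sub_mul] using hM.sub h

/-- Splitting off the first `m` terms of a sequence that reproduces itself, scaled by `q`, under a
shift by `m`. -/
theorem mem_achievementSet_iff_of_shift {m : ℕ} {q : ℝ} (hq : q ≠ 0)
    (hs : ∀ n, x (n + m) = q * x n) {t : ℝ} :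
    t ∈ achievementSet x ↔ ∃ ε : ℕ → ℝ, (∀ n, ε n = 0 ∨ ε n = 1) ∧ ∃ e ∈ achievementSet x,
      t = ∑ i ∈ Finset.range m, ε i * x i + q * e := by
  constructor
  · rintro ⟨ε, hε, h⟩
    refine ⟨ε, hε, (t - ∑ i ∈ Finset.range m, ε i * x i) / q,
      ⟨fun n => ε (n + m), fun n => hε _, ?_⟩, by field_simp; ring⟩
    have h1 := ((hasSum_nat_add_iff' m).2 h).div_const q
    have h2 : (fun n => ε (n + m) * x n) = fun n => ε (n + m) * x (n + m) / q :=
      funext fun n => by rw [hs]; field_simp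
    rw [h2]; exact h1
  · rintro ⟨ε, hε, e, ⟨η, hη, h⟩, rfl⟩
    refine ⟨fun n => if n < m then ε n else η (n - m), fun n => ?_, ?_⟩
    · dsimp only; split_ifs
      exacts [hε n, hη _]
    · have hsum : ∑ i ∈ Finset.range m, ε i * x i =
          ∑ i ∈ Finset.range m, (if i < m then ε i else η (i - m)) * x i :=
        Finset.sum_congr rfl fun i hi => by rw [if_pos (Finset.mem_range.1 hi)]
      rw [hsum, add_comm, ← hasSum_nat_add_iff (f := fun i => (if i < m then ε i else η (i - m)) * x i)]
      have h2 : (fun n => (if n + m < m then ε (n + m) else η (n + m - m)) * x (n + m)) =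
          fun n => q * (η n * x n) := funext fun n => by
        rw [if_neg (by omega), Nat.add_sub_cancel, hs]; ring
      rw [h2]; exact h.mul_left q

/-- Partial sums satisfy `sₙ ≤ sₙ₊ₘ = sₘ + q sₙ`, which bounds them by `sₘ / (1 - q)`. -/
theorem summable_of_shift {m : ℕ} {q : ℝ} (hq : q < 1) (h0 : ∀ n, 0 ≤ x n)
    (hs : ∀ n, x (n + m) = q * x n) : Summable x := by
  refine summable_of_sum_range_le (c := (∑ i ∈ Finset.range m, x i) / (1 - q)) h0 fun n => ?_
  rw [le_div_iff₀ (by linarith)]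
  have h1 : ∑ i ∈ Finset.range n, x i ≤ ∑ i ∈ Finset.range (n + m), x i :=
    Finset.sum_le_sum_of_subset_of_nonneg (Finset.range_mono (by omega)) fun i _ _ => h0 i
  have h2 : ∑ i ∈ Finset.range (n + m), x i =
      ∑ i ∈ Finset.range m, x i + q * ∑ i ∈ Finset.range n, x i := by
    rw [add_comm n m, Finset.sum_range_add, Finset.mul_sum]
    simp_rw [add_comm m, hs]
  linarith

end AchievementSet

theorem exists_nat_eq_sum_of_zero_or_one {ε : ℕ → ℝ} (hε : ∀ n, ε n = 0 ∨ ε n = 1) (k : ℕ) :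
    ∃ c ≤ k, ∑ i ∈ Finset.range k, ε i = (c : ℝ) := by
  induction k with
  | zero => exact ⟨0, le_rfl, by simp⟩
  | succ k ih =>
    obtain ⟨c, hc, h⟩ := ih
    rcases hε k with h' | h'
    · exact ⟨c, by omega, by simp [Finset.sum_range_succ, h, h']⟩
    · exact ⟨c + 1, by omega, by simp [Finset.sum_range_succ, h, h']⟩

/-! ### Endpoints of components and one-point components. -/

section EndpointCriterion

variable {S : Set ℝ}

theorem Icc_subset_connectedComponentIn {x a b : ℝ} (ha : a ∈ connectedComponentIn S x)
    (hb : b ∈ connectedComponentIn S x) : Set.Icc a b ⊆ connectedComponentIn S x :=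
  isPreconnected_connectedComponentIn.ordConnected.out ha hb

/-- In a closed set whose points isolated from the left start no interval, these points
accumulate at the left endpoint of every nondegenerate component. -/
theorem accPt_onePointComponents_of_isLeast (hS : IsClosed S)
    (hl : ∀ a ∈ S, ∀ c < a, (∀ y ∈ S, c < y → a ≤ y) → ∀ b > a, ¬ Set.Icc a b ⊆ S)
    {x a : ℝ} (hint : (interior (connectedComponentIn S x)).Nonempty)
    (ha : IsLeast (connectedComponentIn S x) a) : AccPt a (𝓟 (onePointComponents S)) := by
  have hsub : connectedComponentIn S x ⊆ S := connectedComponentIn_subset S x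
  have haS := hsub ha.1
  have hcomp := connectedComponentIn_eq ha.1
  obtain ⟨b, hab, hb⟩ : ∃ b > a, b ∈ connectedComponentIn S x := by
    by_contra! hcon
    have : connectedComponentIn S x ⊆ {a} := fun y hy =>
      le_antisymm (not_lt.1 fun h => hcon y h hy) (ha.2 hy)
    simpa using hint.mono (interior_mono this)
  have hIcc := (Icc_subset_connectedComponentIn ha.1 hb).trans hsub
  rw [accPt_iff_nhds]
  intro U hU
  obtain ⟨l, hla, hlU⟩ := exists_Ioc_subset_of_mem_nhds hU ⟨a - 1, by linarith⟩
  -- Otherwise the component would extend to the left of `a`.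
  obtain ⟨c, hc, hcS⟩ : ∃ c ∈ Set.Ioo l a, c ∉ S := by
    by_contra! hcon
    obtain ⟨c, hc⟩ := exists_between hla
    have hsubS : Set.Icc c a ⊆ S := fun y hy => by
      rcases hy.2.eq_or_lt with rfl | h
      · exact haS
      · exact hcon y ⟨hc.1.trans_le hy.1, h⟩
    have : Set.Icc c a ⊆ connectedComponentIn S x := by
      rw [hcomp]
      exact isPreconnected_Icc.subset_connectedComponentIn (Set.right_mem_Icc.2 hc.2.le) hsubS
    exact absurd (ha.2 (this (Set.left_mem_Icc.2 hc.2.le))) (not_le.2 hc.2)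
  have hne : (S ∩ Set.Ici c).Nonempty := ⟨a, haS, hc.2.le⟩
  have hbdd : BddBelow (S ∩ Set.Ici c) := ⟨c, fun y hy => hy.2⟩
  have hd := (hS.inter isClosed_Ici).isLeast_csInf hne hbdd
  -- The right end of the gap around `c`: isolated from the left, so by `hl` its component is a
  -- single point and `d ≠ a`.
  set d := sInf (S ∩ Set.Ici c)
  have hcd : c < d := lt_of_le_of_ne hd.1.2 fun h => hcS (h ▸ hd.1.1)
  have hgap : ∀ y ∈ S, c < y → d ≤ y := fun y hy hcy => hd.2 ⟨hy, hcy.le⟩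
  have hda : d ≤ a := hgap a haS hc.2
  have hda' : d ≠ a := by
    intro h
    rw [h] at hgap
    exact hl a haS c hc.2 hgap b hab hIcc
  refine ⟨d, ⟨hlU ⟨hc.1.trans hcd, hda⟩, hd.1.1, ?_⟩, hda'⟩
  refine Set.Subset.antisymm (fun y hy => ?_) (Set.singleton_subset_iff.2
    (mem_connectedComponentIn hd.1.1))
  have hdm := mem_connectedComponentIn hd.1.1
  rcases lt_trichotomy y d with h | h | h
  · exfalso
    have h1 := (Icc_subset_connectedComponentIn hy hdm).trans (connectedComponentIn_subset _ _)
    obtain ⟨z, hz1, hz2⟩ := exists_between (max_lt hcd h)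
    exact absurd (hgap z (h1 ⟨(le_max_right _ _).trans hz1.le, hz2.le⟩)
      ((le_max_left _ _).trans_lt hz1)) (not_le.2 hz2)
  · exact h
  · exact absurd ((Icc_subset_connectedComponentIn hdm hy).trans
      (connectedComponentIn_subset _ _)) (hl d hd.1.1 c hcd hgap y h)

theorem image_sub_onePointComponents {M : ℝ} (hsymm : (fun y => M - y) '' S = S) :
    (fun y => M - y) '' onePointComponents S ⊆ onePointComponents S := by
  rintro _ ⟨y, ⟨hy, hy1⟩, rfl⟩
  have h := (Homeomorph.subLeft M).image_connectedComponentIn hy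
  rw [hy1, Set.image_singleton] at h
  refine ⟨hsymm ▸ Set.mem_image_of_mem _ hy, ?_⟩
  change _ = connectedComponentIn ((fun y => M - y) '' S) (M - y) at h
  rw [hsymm] at h
  exact h.symm

theorem accPt_onePointComponents_of_isGreatest (hS : IsClosed S) {M : ℝ}
    (hsymm : (fun y => M - y) '' S = S)
    (hl : ∀ a ∈ S, ∀ c < a, (∀ y ∈ S, c < y → a ≤ y) → ∀ b > a, ¬ Set.Icc a b ⊆ S)
    {x a : ℝ} (hint : (interior (connectedComponentIn S x)).Nonempty)
    (ha : IsGreatest (connectedComponentIn S x) a) : AccPt a (𝓟 (onePointComponents S)) := by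
  have hx : x ∈ S := by
    by_contra h
    simp [connectedComponentIn_eq_empty h] at hint
  have h := (Homeomorph.subLeft M).image_connectedComponentIn hx
  change (fun y => M - y) '' _ = connectedComponentIn ((fun y => M - y) '' S) (M - x) at h
  rw [hsymm] at h
  have hint' : (interior (connectedComponentIn S (M - x))).Nonempty := by
    rw [← h]
    have := (Homeomorph.subLeft M).image_interior (connectedComponentIn S x)
    change _ = interior ((fun y => M - y) '' _) at this
    rw [← this]
    exact hint.image _
  have ha' : IsLeast (connectedComponentIn S (M - x)) (M - a) := by
    rw [← h]
    refine ⟨Set.mem_image_of_mem _ ha.1, ?_⟩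
    rintro _ ⟨y, hy, rfl⟩
    exact sub_le_sub_left (ha.2 hy) M
  have hacc := accPt_onePointComponents_of_isLeast hS hl hint' ha'
  rw [accPt_iff_nhds] at hacc ⊢
  intro U hU
  have hcont : Filter.Tendsto (fun y => M - y) (𝓝 (M - a)) (𝓝 a) := by
    simpa using (by fun_prop : Continuous fun y : ℝ => M - y).tendsto (M - a)
  obtain ⟨y, ⟨hyU, hyS⟩, hya⟩ := hacc _ (hcont hU)
  exact ⟨M - y, ⟨hyU, image_sub_onePointComponents hsymm (Set.mem_image_of_mem _ hyS)⟩,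
    fun h => hya (by linarith)⟩

end EndpointCriterion

/-! ### Digit sums in base `2k + 2`. -/

/-- The integers `∑ i < n, dᵢ (2k + 2) ^ i` with digits `dᵢ` in `{3a + 2c | a ≤ 1, c ≤ k}`. -/
def digitSums (k : ℕ) : ℕ → Set ℕ
  | 0 => {0}
  | n + 1 => {m | ∃ f ∈ digitSums k n, ∃ a ≤ 1, ∃ c ≤ k, m = (2 * k + 2) * f + (3 * a + 2 * c)}

/-- The integer `∑ i < n, 2 (2k + 2) ^ i`. -/
def sumTwos (k : ℕ) : ℕ → ℕ
  | 0 => 0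
  | n + 1 => (2 * k + 2) * sumTwos k n + 2

theorem sumTwos_mul (k n : ℕ) : sumTwos k n * (2 * k + 1) + 2 = 2 * (2 * k + 2) ^ n := by
  induction n with
  | zero => simp [sumTwos]
  | succ n ih =>
    simp only [sumTwos, pow_succ]
    linear_combination (2 * k + 2) * ih

/-- The digits form a complete residue system modulo `2k + 2`, so that the digit sums contain a
long block of consecutive integers. -/
theorem mem_digitSums {k : ℕ} (hk : 1 ≤ k) (n m : ℕ) (h1 : sumTwos k n ≤ m)
    (h2 : m < (2 * k + 2) ^ n) : m ∈ digitSums k n := by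
  induction n generalizing m with
  | zero => simpa [digitSums] using h2
  | succ n ih =>
    simp only [sumTwos] at h1
    rw [pow_succ'] at h2
    have hr := Nat.mod_lt m (show 0 < 2 * k + 2 by omega)
    have hm := Nat.div_add_mod m (2 * k + 2)
    generalize m % (2 * k + 2) = r at hr hm
    generalize m / (2 * k + 2) = f at hm
    have hf : f < (2 * k + 2) ^ n := by
      by_contra! h
      have := Nat.mul_le_mul_left (2 * k + 2) h
      omega
    -- The quotient is at least `sumTwos k n`, with equality only if `r ≥ 2`; this leaves room for
    -- the borrow when `r = 1`.
    have hle : ∀ s, sumTwos k n = f + s → s = 0 ∧ 2 ≤ r := by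
      intro s hs
      rw [hs, mul_add] at h1
      rcases s.eq_zero_or_pos with rfl | h
      · omega
      · have := Nat.le_mul_of_pos_right (2 * k + 2) h
        omega
    have hge : sumTwos k n ≤ f := by
      by_contra! h
      have := hle (sumTwos k n - f) (by omega)
      omega
    rcases Nat.even_or_odd' r with ⟨c, rfl | rfl⟩
    · exact ⟨f, ih f hge hf, 0, by omega, c, by omega, by omega⟩
    · rcases c.eq_zero_or_pos with rfl | hc
      · have hne : sumTwos k n ≠ f := fun h => by have := hle 0 h; omega
        obtain ⟨g, rfl⟩ : ∃ g, f = g + 1 := ⟨f - 1, by omega⟩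
        -- Residue `1` is represented by the digit `2k + 3`, borrowing one from the quotient.
        exact ⟨g, ih g (by omega) (by omega), 1, le_rfl, k, le_rfl, by rw [← hm]; ring⟩
      · exact ⟨f, ih f hge hf, 1, le_rfl, c - 1, by omega, by omega⟩

/-! ### Interior and gaps of the self-similar set. -/

section SelfSimilar

variable {S : Set ℝ} {k : ℕ}

/-- Iterates the self-similarity `n` times. The extra factor `2k + 2` on `f` appears because the
first digit has weight `1` in `t` but `(2k + 2) ^ (n - 1)` in `f`. -/
theorem mem_iff_digitSums
    (hself : ∀ t, t ∈ S ↔ ∃ a : ℕ, a ≤ 1 ∧ ∃ c : ℕ, c ≤ k ∧ ∃ e ∈ S,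
      t = 3 * a + 2 * c + e / (2 * k + 2)) (n : ℕ) (t : ℝ) :
    t ∈ S ↔ ∃ f ∈ digitSums k n, ∃ e ∈ S, (2 * k + 2 : ℝ) ^ n * t = (2 * k + 2) * f + e := by
  have hN : (2 * k + 2 : ℝ) ≠ 0 := by positivity
  induction n with
  | zero => simp [digitSums]
  | succ n ih =>
    refine ih.trans ⟨?_, ?_⟩
    · rintro ⟨f, hf, e, he, h⟩
      obtain ⟨a, ha, c, hc, e', he', rfl⟩ := (hself e).1 he
      refine ⟨_, ⟨f, hf, a, ha, c, hc, rfl⟩, e', he', ?_⟩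
      rw [pow_succ', mul_assoc, h]
      push_cast
      field_simp
      ring
    · rintro ⟨_, ⟨f, hf, a, ha, c, hc, rfl⟩, e', he', h⟩
      refine ⟨f, hf, _, (hself _).2 ⟨a, ha, c, hc, e', he', rfl⟩, ?_⟩
      rw [pow_succ', mul_assoc] at h
      push_cast at h
      apply mul_left_cancel₀ hN
      rw [h]
      field_simp
      ring

theorem div_pow_mem
    (hself : ∀ t, t ∈ S ↔ ∃ a : ℕ, a ≤ 1 ∧ ∃ c : ℕ, c ≤ k ∧ ∃ e ∈ S,
      t = 3 * a + 2 * c + e / (2 * k + 2)) (h0 : (0 : ℝ) ∈ S) {n f : ℕ}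
    (hf : f ∈ digitSums k n) : (2 * k + 2 : ℝ) * f / (2 * k + 2) ^ n ∈ S :=
  (mem_iff_digitSums hself n _).2 ⟨f, hf, 0, h0, by field_simp; ring⟩

theorem exists_div_pow_lt {ε : ℝ} (hε : 0 < ε) (k : ℕ) (C : ℝ) :
    ∃ n, C / (2 * k + 2 : ℝ) ^ n < ε := by
  obtain ⟨n, hn⟩ := pow_unbounded_of_one_lt (C / ε)
    (show (1 : ℝ) < 2 * k + 2 by have := k.cast_nonneg (α := ℝ); linarith)
  refine ⟨n, ?_⟩
  rw [div_lt_iff₀ hε] at hn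
  rw [div_lt_iff₀ (by positivity)]
  linarith

/-- Finite digit sums give points of `S` with spacing `(2k + 2) / (2k + 2) ^ n`; the left end is the
limit of the rescaled `sumTwos k n`. -/
theorem Ioo_subset_of_selfSimilar (hk : 1 ≤ k) (hS : IsClosed S)
    (hself : ∀ t, t ∈ S ↔ ∃ a : ℕ, a ≤ 1 ∧ ∃ c : ℕ, c ≤ k ∧ ∃ e ∈ S,
      t = 3 * a + 2 * c + e / (2 * k + 2)) (h0 : (0 : ℝ) ∈ S) :
    Set.Ioo (2 * (2 * k + 2) / (2 * k + 1) : ℝ) (2 * k + 2) ⊆ S := by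
  rintro x ⟨hx1, hx2⟩
  rw [← hS.closure_eq, Metric.mem_closure_iff]
  intro ε hε
  obtain ⟨n, hn⟩ := exists_div_pow_lt hε k (2 * k + 2)
  have hN : (0 : ℝ) < 2 * k + 2 := by positivity
  have hP : (0 : ℝ) < (2 * k + 2 : ℝ) ^ n := by positivity
  set y : ℝ := (2 * k + 2) ^ n * x / (2 * k + 2) with hy
  have hx0 : 0 < x := lt_trans (by positivity) hx1
  have hy0 : 0 ≤ y := by positivity
  have hf1 := Nat.floor_le hy0
  have hf2 := Nat.lt_floor_add_one y
  have hxy : x = (2 * k + 2) * y / (2 * k + 2) ^ n := by rw [hy]; field_simp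
  refine ⟨_, div_pow_mem hself h0 (mem_digitSums hk n ⌊y⌋₊ (Nat.le_floor ?_) ?_), ?_⟩
  · have h : (sumTwos k n : ℝ) * (2 * k + 1) + 2 = 2 * (2 * k + 2) ^ n := by
      exact_mod_cast sumTwos_mul k n
    rw [hy, le_div_iff₀ hN]
    rw [div_lt_iff₀ (by positivity)] at hx1
    have h3 := mul_lt_mul_of_pos_left hx1 hP
    nlinarith
  · rw [Nat.floor_lt hy0]
    push_cast
    rw [hy, div_lt_iff₀ hN]
    exact mul_lt_mul_of_pos_left hx2 hP
  · rw [Real.dist_eq, hxy, ← sub_div, ← mul_sub, abs_of_nonneg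
      (div_nonneg (mul_nonneg hN.le (sub_nonneg.2 hf1)) hP.le)]
    refine lt_of_le_of_lt ?_ hn
    gcongr
    nlinarith

/-- Each point lies in a copy of `S` of diameter at most `M / (2k + 2) ^ n`, which contains a copy
of an interior point. -/
theorem closure_interior_of_selfSimilar (hS : IsClosed S) {M : ℝ}
    (hM : ∀ t ∈ S, 0 ≤ t ∧ t ≤ M) (hint : (interior S).Nonempty)
    (hself : ∀ t, t ∈ S ↔ ∃ a : ℕ, a ≤ 1 ∧ ∃ c : ℕ, c ≤ k ∧ ∃ e ∈ S,
      t = 3 * a + 2 * c + e / (2 * k + 2)) :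
    closure (interior S) = S := by
  refine Set.Subset.antisymm (closure_minimal interior_subset hS) fun x hx => ?_
  obtain ⟨y, hy⟩ := hint
  rw [Metric.mem_closure_iff]
  intro ε hε
  obtain ⟨n, hn⟩ := exists_div_pow_lt hε k M
  have hN : (0 : ℝ) < 2 * k + 2 := by positivity
  have hP : (0 : ℝ) < (2 * k + 2 : ℝ) ^ n := by positivity
  obtain ⟨f, hf, e, he, hfe⟩ := (mem_iff_digitSums hself n x).1 hx
  refine ⟨((2 * k + 2) * f + y) / (2 * k + 2) ^ n, ?_, ?_⟩
  · have hcont : Continuous fun z : ℝ => (2 * k + 2) ^ n * z - (2 * k + 2) * f := by fun_prop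
    refine interior_maximal (s := S) ?_ ((isOpen_interior (s := S)).preimage hcont) ?_
    · intro z hz
      exact (mem_iff_digitSums hself n z).2 ⟨f, hf, _, interior_subset hz, by ring⟩
    · simp only [Set.mem_preimage]
      rwa [mul_div_cancel₀ _ hP.ne', add_sub_cancel_left]
  · have hx' : x = ((2 * k + 2) * f + e) / (2 * k + 2) ^ n := by
      rw [← hfe]; field_simp
    rw [Real.dist_eq, hx', ← sub_div, add_sub_add_left_eq_sub, abs_div, abs_of_pos hP]
    refine lt_of_le_of_lt ?_ hn
    gcongr
    have h1 := hM e he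
    have h2 := hM y (interior_subset hy)
    rw [abs_le]
    constructor <;> linarith

/-- A point isolated from the left is a digit sum, and the set looks to its right like it does to
the right of `0`, where there are gaps. -/
theorem not_Icc_subset_of_selfSimilar (h0 : (0 : ℝ) ∈ S) {M : ℝ}
    (hM : ∀ t ∈ S, 0 ≤ t ∧ t ≤ M) (hM2 : M < 2 * (2 * k + 2))
    (hself : ∀ t, t ∈ S ↔ ∃ a : ℕ, a ≤ 1 ∧ ∃ c : ℕ, c ≤ k ∧ ∃ e ∈ S,
      t = 3 * a + 2 * c + e / (2 * k + 2)) :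
    ∀ a ∈ S, ∀ c < a, (∀ y ∈ S, c < y → a ≤ y) → ∀ b > a, ¬ Set.Icc a b ⊆ S := by
  intro a ha c hca hgap b hab hsub
  have hN : (0 : ℝ) < 2 * k + 2 := by positivity
  have hk0 : (0 : ℝ) ≤ k := k.cast_nonneg
  have hM0 : 0 ≤ M := (hM 0 h0).2
  -- A point in the gap `(M / (2k + 2), 2)`: first digit `0` gives at most the left end, any other
  -- digit at least `2`.
  obtain ⟨t, ht1, ht2⟩ := exists_between ((div_lt_iff₀ hN).2 hM2)
  have ht0 : 0 ≤ t := (div_nonneg hM0 hN.le).trans ht1.le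
  have htS : t ∉ S := by
    intro ht
    obtain ⟨u, hu, v, hv, e, he, rfl⟩ := (hself t).1 ht
    have he1 : e / (2 * k + 2) ≤ M / (2 * k + 2) := div_le_div_of_nonneg_right (hM e he).2 hN.le
    have he2 : 0 ≤ e / (2 * k + 2) := div_nonneg (hM e he).1 hN.le
    have huv : ((3 * u + 2 * v : ℕ) : ℝ) < (2 : ℕ) := by push_cast; linarith
    rw [Nat.cast_lt] at huv
    obtain ⟨rfl, rfl⟩ : u = 0 ∧ v = 0 := by omega
    simp at ht1
    linarith
  -- `M` bounds the remainder, keeping truncations to the right of `c`; `2` bounds `t`, keeping `a +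
  -- t / P` below `b`.
  obtain ⟨n, hn⟩ := exists_div_pow_lt (lt_min (sub_pos.2 hca) (sub_pos.2 hab)) k (M + 2)
  have hP : (0 : ℝ) < (2 * k + 2 : ℝ) ^ n := by positivity
  rw [div_lt_iff₀ hP] at hn
  set P : ℝ := (2 * k + 2 : ℝ) ^ n with hPdef
  have hn1 : M + 2 < (a - c) * P := hn.trans_le (by gcongr; exact min_le_left _ _)
  have hn2 : M + 2 < (b - a) * P := hn.trans_le (by gcongr; exact min_le_right _ _)
  -- The digit sum of any point of `S` slightly to the right of `a` is at least `a`.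
  have key : ∀ f ∈ digitSums k n, P * a - M ≤ (2 * k + 2) * f → P * a ≤ (2 * k + 2) * f := by
    intro f hf h
    have h1 := hgap _ (div_pow_mem hself h0 hf) (by rw [lt_div_iff₀ hP]; linarith)
    rw [le_div_iff₀ hP] at h1
    linarith
  obtain ⟨f, hf, e, he, hfe⟩ := (mem_iff_digitSums hself n a).1 ha
  have hfa : P * a = (2 * k + 2) * f :=
    le_antisymm (key f hf (by linarith [(hM e he).2])) (by linarith [(hM e he).1])
  have hx : a + t / P ∈ S := by
    refine hsub ⟨by linarith [div_nonneg ht0 hP.le], ?_⟩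
    have : t / P ≤ b - a := by rw [div_le_iff₀ hP]; linarith
    linarith
  obtain ⟨g, hg, e', he', hge⟩ := (mem_iff_digitSums hself n _).1 hx
  have hPt : P * (a + t / P) = P * a + t := by field_simp
  rw [← hPdef, hPt] at hge
  have hga := key g hg (by linarith [(hM e' he').2])
  -- No digit sum lies just below `P * a`, and `t < 2 ≤ 2k + 2` excludes the next one above.
  have hgf : g = f := by
    apply le_antisymm
    · by_contra! h
      have h' : (f : ℝ) + 1 ≤ g := by exact_mod_cast h
      have := mul_le_mul_of_nonneg_left h' hN.le
      linarith [(hM e' he').1]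
    · rw [hfa] at hga
      exact_mod_cast le_of_mul_le_mul_left hga hN
  apply htS
  rwa [show t = e' by rw [hgf] at hge; linarith]

end SelfSimilar

/-! ### Multigeometric sequences and the case `(3, 2, …, 2; q)`. -/

section Multigeometric

variable {m : ℕ} [NeZero m] {a : Fin m → ℝ} {q : ℝ}

theorem multigeometric_add (n : ℕ) :
    multigeometric a q (n + m) = q * multigeometric a q n := by
  have h : Fin.ofNat m (n + m) = Fin.ofNat m n := by ext; simp
  simp only [multigeometric, h, Nat.add_div_right n (NeZero.pos m), pow_succ]
  ring

theorem multigeometric_fin (i : Fin m) : multigeometric a q i = a i := by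
  simp [multigeometric, Nat.div_eq_of_lt i.2]

theorem multigeometric_nonneg (ha : ∀ i, 0 ≤ a i) (hq : 0 ≤ q) (n : ℕ) :
    0 ≤ multigeometric a q n :=
  mul_nonneg (ha _) (pow_nonneg hq _)

end Multigeometric

theorem sum_range_mul_multigeometric_cons (k : ℕ) (q : ℝ) (ε : ℕ → ℝ) :
    ∑ i ∈ Finset.range (k + 1),
        ε i * multigeometric (Fin.cons 3 (fun _ : Fin k => 2) : Fin (k + 1) → ℝ) q i =
      3 * ε 0 + 2 * ∑ i ∈ Finset.range k, ε (i + 1) := by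
  rw [Finset.sum_range]
  simp_rw [multigeometric_fin]
  rw [Fin.sum_univ_succ, Finset.sum_range, Finset.mul_sum]
  simp [mul_comm]

theorem mem_achievementSet_multigeometric_iff (k : ℕ) (t : ℝ) :
    t ∈ achievementSet (multigeometric (Fin.cons 3 (fun _ : Fin k => 2) : Fin (k + 1) → ℝ)
        (1 / (2 * (k : ℝ) + 2))) ↔
      ∃ a : ℕ, a ≤ 1 ∧ ∃ c : ℕ, c ≤ k ∧
        ∃ e ∈ achievementSet (multigeometric (Fin.cons 3 (fun _ : Fin k => 2) : Fin (k + 1) → ℝ)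
          (1 / (2 * (k : ℝ) + 2))), t = 3 * a + 2 * c + e / (2 * k + 2) := by
  rw [mem_achievementSet_iff_of_shift (by positivity) multigeometric_add]
  simp_rw [sum_range_mul_multigeometric_cons, one_div_mul_eq_div]
  constructor
  · rintro ⟨ε, hε, e, he, rfl⟩
    obtain ⟨c, hc, h⟩ := exists_nat_eq_sum_of_zero_or_one (fun n => hε (n + 1)) k
    rw [h]
    rcases hε 0 with h0 | h0 <;> rw [h0]
    · exact ⟨0, by omega, c, hc, e, he, by simp⟩
    · exact ⟨1, le_rfl, c, hc, e, he, by simp⟩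
  · rintro ⟨a, ha, c, hc, e, he, rfl⟩
    -- Index `0` carries the `3`; the first `c` of the twos are selected.
    refine ⟨fun n => if n = 0 then (a : ℝ) else if n < c + 1 then 1 else 0, fun n => ?_, e, he, ?_⟩
    · dsimp only
      split_ifs
      · interval_cases a <;> simp
      · simp
      · simp
    · have : (Finset.range k).filter (· < c) = Finset.range c := by
        ext i; simp; omega
      simp [this]

theorem theorem7 (k : ℕ) (hk : 1 ≤ k) :
    IsCantorval (achievementSet
      (multigeometric (Fin.cons 3 (fun _ : Fin k => 2) : Fin (k + 1) → ℝ)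
        (1 / (2 * (k : ℝ) + 2)))) := by
  have hself := mem_achievementSet_multigeometric_iff k
  have hsum := sum_range_mul_multigeometric_cons k (1 / (2 * (k : ℝ) + 2)) fun _ => 1
  have hshift := multigeometric_add (a := (Fin.cons 3 (fun _ : Fin k => 2) : Fin (k + 1) → ℝ))
    (q := 1 / (2 * (k : ℝ) + 2))
  have hx0 := multigeometric_nonneg (a := (Fin.cons 3 (fun _ : Fin k => 2) : Fin (k + 1) → ℝ))
    (q := 1 / (2 * (k : ℝ) + 2)) (fun i => by refine Fin.cases ?_ (fun j => ?_) i <;> simp)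
    (by positivity)
  generalize multigeometric (Fin.cons 3 (fun _ : Fin k => 2) : Fin (k + 1) → ℝ)
    (1 / (2 * (k : ℝ) + 2)) = x at *
  have hk1 : (1 : ℝ) ≤ k := by exact_mod_cast hk
  have hx := summable_of_shift (by rw [div_lt_one] <;> linarith) hx0 hshift
  have h0 : (0 : ℝ) ∈ achievementSet x := zero_mem_achievementSet
  have hcomp := isCompact_achievementSet hx hx0
  have hM : ∀ t ∈ achievementSet x, 0 ≤ t ∧ t ≤ ∑' n, x n := fun t ht =>
    ⟨nonneg_of_mem_achievementSet hx0 ht, sub_nonneg.1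
      (nonneg_of_mem_achievementSet hx0 (sub_mem_achievementSet hx.hasSum ht))⟩
  -- The total is `(2k + 3)(2k + 2)/(2k + 1)`, so the bound amounts to `2k > 1`.
  have hM2 : ∑' n, x n < 2 * (2 * k + 2) := by
    have h := hx.sum_add_tsum_nat_add (k + 1)
    simp only [one_mul] at hsum
    simp_rw [hshift, tsum_mul_left, hsum] at h
    simp at h
    field_simp at h
    nlinarith
  have hint : (interior (achievementSet x)).Nonempty := by
    refine Set.Nonempty.mono (interior_maximal
      (Ioo_subset_of_selfSimilar hk hcomp.isClosed hself h0) isOpen_Ioo) (Set.nonempty_Ioo.2 ?_)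
    rw [div_lt_iff₀ (by positivity)]
    nlinarith
  have hl := not_Icc_subset_of_selfSimilar h0 hM hM2 hself
  have hsymm : (fun y => ∑' n, x n - y) '' achievementSet x = achievementSet x := by
    refine Set.Subset.antisymm ?_ fun y hy =>
      ⟨_, sub_mem_achievementSet hx.hasSum hy, sub_sub_cancel _ _⟩
    rintro _ ⟨y, hy, rfl⟩
    exact sub_mem_achievementSet hx.hasSum hy
  refine ⟨⟨0, h0⟩, hcomp, closure_interior_of_selfSimilar hcomp.isClosed hM hint hself, ?_⟩
  rintro y - hy a (ha | ha)
  · exact accPt_onePointComponents_of_isLeast hcomp.isClosed hl hy ha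
  · exact accPt_onePointComponents_of_isGreatest hcomp.isClosed hsymm hl hy ha
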